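/- **Setting.** Let $K,s,m,d\ge 0$ be integers and let $(\Omega,\mathbb F,(\mathcal F_t)_{t\in\mathbb Z_+},\mathbb P)$ be a filtered probability space. Let $\xi(t)=(\xi_i(t))_{i=1}^K$, $\xi_i(t)=(\rho_i(t),\sigma_i(t))\in\mathbb R\times\mathbb R^d$ (slow variables) and $\bar\theta(t)=(\bar\theta_i(t))_{i=1}^s$, $\bar\theta_i(t)\in\mathbb R^{md}$ (fast variables) be $(\mathcal F_t)$-adapted. The stepsizes $\alpha(n),\beta(n)>0$ satisfy $\sum_n\alpha(n)=\sum_n\beta(n)=\infty$, $\sum_n(\alpha(n)^2+\beta(n)^2)<\infty$ and $\beta(n)/\alpha(n)\to0$. Consider the recursions $$\xi_i(t+1)=\xi_i(t)+\beta(t)\big[h_{\phi,i}(\xi(t),\bar\theta(t))+M_{\phi,i}(t+1)\big],\qquad(1)$$ $$\bar\theta_i(t+1)=\bar\theta_i(t)+\alpha(t)\big[h_{\theta,i}(\xi(t),\bar\theta(t))+M_{\theta,i}(t+1)\big].\qquad(2)$$ **Asymptotic stability in a region.** A point $x$ is an asymptotically stable equilibrium of $\dot y=f(y)$ in a region $D$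 if $x\in D$, $f(x)=0$, $x$ is Lyapunov stable (for every $\varepsilon>0$ there is $\delta>0$ such that every solution on a time interval $[0,T]$ with values in $D$ and $|y(0)-x|<\delta$ satisfies $|y(t)-x|<\varepsilon$ on $[0,T]$), and every solution on $[0,\infty)$ that remains in $D$ converges to $x$. (For $D$ the whole space this is global asymptotic stability.) **Hypotheses.** Let $U\subseteq(\mathbb R\times\mathbb R^d)^K$ and $V\subseteq(\mathbb R^{md})^s$ be open (possibly the whole spaces) such that - (stable iterates) almost surely there is a (random) compact set $C\subset U\times V$ with $(\xi(t),\bar\theta(t))\in C$ for all sufficiently large $t$ (for $U,V$ the whole spaces: the iterates are almost surely bounded); - (drifts) $h_\phi,h_\theta$ are locally Lipschitz on $U\times V$; - (noise) for $M=M_\phi$ and $M=M_\theta$: $M(t+1)$ is square integrable and $\mathcal F_{t+1}$-measurable, $\mathbb E[M(t+1)\mid\mathcal F_t]=0$, and $\mathbb E[\|M(t+1)\|^2\mid\mathcal F_t]\le C_M(1+\|\xi(t)\|^2+\|\bar\theta(t)\|^2)$ almost surely for all $t$, with a constant $C_M$; - (fast ODE) there is a Lipschitz map $\lambda:U\to V$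 such that for each fixed $\xi\in U$ the point $\lambda(\xi)$ is an asymptotically stable equilibrium of $\dot{\bar\theta}=h_\theta(\xi,\bar\theta)$ in $V$; - (slow ODE) $\xi^*$ is an asymptotically stable equilibrium of $\dot\xi=h_\phi(\xi,\lambda(\xi))$ in $U$. **Theorem.** (i) Under these hypotheses, if $(\xi(t),\bar\theta(t))$ satisfies (1) and (2) almost surely for all $t$, then almost surely $(\xi(t),\bar\theta(t))\to(\xi^*,\lambda(\xi^*))$. (ii) In particular, this holds for the following combined algorithm of online deterministic annealing (ODA) and recursive identification. For a strictly convex, twice differentiable $g$ let $d_g(x,\mu)=g(x)-g(\mu)-Dg(\mu)(x-\mu)$ be its Bregman divergence, and fix Bregman divergences (all denoted $d$) on $\mathbb R^{m+d}$, $\mathbb R^d$ and $\mathbb R^{md}$ and a temperature coefficient $\tau\in(0,1)$. The data $x_t=(\psi_t,\phi_t)\in\mathbb R^m\times\mathbb R^d$ have a common law $Q$ with finite second moment. Put $\hat\phi_i=\sigma_i/\rho_i$, where $\rho_i>0$ for all $i$ throughout $U$. To each codevector $j\in\{1,\dots,K\}$ is attached a parameter $\hat\theta_j$, possibly depending on $\bar\theta$,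 and a mode $a(j)=a_{\bar\theta}(j)\in\operatorname{argmin}_k d(\hat\theta_j,\bar\theta_k)$; the local model used at $j$ is the one with parameter $\bar\theta_{a(j)}$. With $\mu_i=\big([\phi^{\mathsf T}\otimes I_m]\bar\theta_{a(i)},\hat\phi_i\big)$ and $$\hat p_i=\frac{\rho_i\,e^{-\frac{1-\tau}{\tau}d(x,\mu_i)}}{\sum_j\rho_j\,e^{-\frac{1-\tau}{\tau}d(x,\mu_j)}},$$ the slow updates are $$\rho_i(t+1)=\rho_i(t)+\beta(t)[\hat p_i(t)-\rho_i(t)],\qquad \sigma_i(t+1)=\sigma_i(t)+\beta(t)[\phi_t\hat p_i(t)-\sigma_i(t)].$$ With the Voronoi cells $\Sigma_j=\{\phi: j=\operatorname{argmin}_k d(\phi,\hat\phi_k)\}$ (ties going to the smallest index), $S_i=\bigcup_{a(j)=i}\Sigma_j$ and $\epsilon=\sum_i\mathbf 1_{[\phi\in S_i]}[\phi^{\mathsf T}\otimes I_m]\bar\theta_i-\psi$, the fast updates are $$\bar\theta_i(t+1)=\bar\theta_i(t)-\alpha(t)\,\mathbf 1_{[\phi_t\in S_i]}[\phi_t^{\mathsf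 T}\otimes I_m]^{\mathsf T}\epsilon(t).$$ Let $h_\phi(\xi,\bar\theta)$ and $h_\theta(\xi,\bar\theta)$ be the expectations, with respect to $(\psi,\phi)\sim Q$, of the increments (the factors multiplying $\beta$ and $\alpha$) at fixed $(\xi,\bar\theta)$, and let $M_\phi(t+1),M_\theta(t+1)$ be the increments at time $t$ minus $h_\phi(\xi(t),\bar\theta(t))$, $h_\theta(\xi(t),\bar\theta(t))$. If the hypotheses above hold for these $h_\phi,h_\theta,M_\phi,M_\theta$, then almost surely $(\xi(t),\bar\theta(t))\to(\xi^*,\lambda(\xi^*))$. -/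

import Mathlib

open MeasureTheory ProbabilityTheory Filter Topology Set
open scoped BigOperators

/-! ### Asymptotic stability of equilibria of autonomous ODEs -/

/-- `y` solves `ẏ = f y` on the time interval `J`. -/
def IsODESolutionOn {V : Type*} [NormedAddCommGroup V] [NormedSpace ℝ V]
    (f : V → V) (J : Set ℝ) (y : ℝ → V) : Prop :=
  ∀ t ∈ J, HasDerivWithinAt y (f (y t)) J t

/-- `x` is an asymptotically stable equilibrium of `ẏ = f y` in the region `D`: it is an
equilibrium in `D`, it is Lyapunov stable (finite-time solutions are included, so that a solution
cannot escape the test by leaving `D`), and it attracts every forward solution that remains in `D`.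
For `D = univ` this is global asymptotic stability. -/
structure IsAsymptoticallyStableOn {V : Type*} [NormedAddCommGroup V] [NormedSpace ℝ V]
    (f : V → V) (D : Set V) (x : V) : Prop where
  mem : x ∈ D
  equilibrium : f x = 0
  stable : ∀ ε > 0, ∃ δ > 0, ∀ T > 0, ∀ y : ℝ → V,
    IsODESolutionOn f (Icc 0 T) y → (∀ t ∈ Icc 0 T, y t ∈ D) →
      dist (y 0) x < δ → ∀ t ∈ Icc 0 T, dist (y t) x < ε
  attractive : ∀ y : ℝ → V,
    IsODESolutionOn f (Ici 0) y → (∀ t ∈ Ici (0 : ℝ), y t ∈ D) → Tendsto y atTop (𝓝 x)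

/-! ### Stepsizes, noise and the standing conditions of stochastic approximation -/

/-- Stepsizes `α` (fast) and `β` (slow). -/
structure IsTwoTimescaleStepsize (α β : ℕ → ℝ) : Prop where
  fast_pos : ∀ n, 0 < α n
  slow_pos : ∀ n, 0 < β n
  fast_sum : Tendsto (fun n => ∑ k ∈ Finset.range n, α k) atTop atTop
  slow_sum : Tendsto (fun n => ∑ k ∈ Finset.range n, β k) atTop atTop
  sq_summable : Summable (fun n => α n ^ 2 + β n ^ 2)
  ratio : Tendsto (fun n => β n / α n) atTop (𝓝 0)

/-- `(M (t + 1))` is a square-integrable martingale difference sequence for the filtration `ℱ`,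
whose conditional second moments grow at most quadratically in the iterates `(ξ, θ)`. -/
structure IsMartingaleNoise {Ω E F V : Type*} {mΩ : MeasurableSpace Ω}
    [NormedAddCommGroup E] [NormedAddCommGroup F] [NormedAddCommGroup V] [NormedSpace ℝ V]
    [CompleteSpace V]
    (P : Measure Ω) (ℱ : Filtration ℕ mΩ) (ξ : ℕ → Ω → E) (θ : ℕ → Ω → F)
    (M : ℕ → Ω → V) : Prop where
  adapted : ∀ t, StronglyMeasurable[ℱ (t + 1)] (M (t + 1))
  memLp : ∀ t, MemLp (M (t + 1)) 2 P
  condExp_eq_zero : ∀ t, P[M (t + 1) | ℱ t] =ᵐ[P] 0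
  growth : ∃ C : ℝ, ∀ t, ∀ᵐ ω ∂P,
    (P[fun ω' => ‖M (t + 1) ω'‖ ^ 2 | ℱ t]) ω ≤ C * (1 + ‖ξ t ω‖ ^ 2 + ‖θ t ω‖ ^ 2)

/-- The conditions on the drifts `hslow`, `hfast`, the noises `Mslow`, `Mfast` and the two limiting
ODEs, on the region `U` of slow variables and the region `V` of fast variables: the drifts are
locally Lipschitz on `U × V`, the noises are martingale differences, for every frozen `ξ ∈ U` the
fast ODE has the asymptotically stable equilibrium `lam ξ` with `lam` Lipschitz, and the slow ODE
has the asymptotically stable equilibrium `ξlim`. -/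
structure TwoTimescaleConditions {Ω E F : Type*} {mΩ : MeasurableSpace Ω}
    [NormedAddCommGroup E] [NormedSpace ℝ E] [CompleteSpace E]
    [NormedAddCommGroup F] [NormedSpace ℝ F] [CompleteSpace F]
    (P : Measure Ω) (ℱ : Filtration ℕ mΩ) (ξ : ℕ → Ω → E) (θ : ℕ → Ω → F)
    (U : Set E) (V : Set F) (hslow : E → F → E) (hfast : E → F → F)
    (Mslow : ℕ → Ω → E) (Mfast : ℕ → Ω → F) (lam : E → F) (ξlim : E) : Prop where
  slow_lipschitz : LocallyLipschitzOn (U ×ˢ V) (fun p : E × F => hslow p.1 p.2)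
  fast_lipschitz : LocallyLipschitzOn (U ×ˢ V) (fun p : E × F => hfast p.1 p.2)
  slow_noise : IsMartingaleNoise P ℱ ξ θ Mslow
  fast_noise : IsMartingaleNoise P ℱ ξ θ Mfast
  lam_lipschitz : ∃ L, LipschitzOnWith L lam U
  fast_ode : ∀ x ∈ U, IsAsymptoticallyStableOn (hfast x) V (lam x)
  slow_ode : IsAsymptoticallyStableOn (fun x => hslow x (lam x)) U ξlim

/-! ### Bregman divergences -/

/-- A strictly convex, twice Fréchet differentiable function. -/
structure IsBregmanGenerator {S : Type*} [NormedAddCommGroup S] [NormedSpace ℝ S]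
    (g : S → ℝ) : Prop where
  strictConvex : StrictConvexOn ℝ univ g
  differentiable : Differentiable ℝ g
  differentiable_fderiv : Differentiable ℝ (fderiv ℝ g)

/-- The Bregman divergence of `g`. -/
noncomputable def bregman {S : Type*} [NormedAddCommGroup S] [NormedSpace ℝ S]
    (g : S → ℝ) (x μ : S) : ℝ :=
  g x - g μ - fderiv ℝ g μ (x - μ)

/-! ### The combined mode and dynamics identification algorithm -/

/-- Outputs `ψ ∈ ℝ^m`. -/
abbrev OutSpace (m : ℕ) := EuclideanSpace ℝ (Fin m)

/-- Regressors `φ ∈ ℝ^d`. -/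
abbrev RegSpace (d : ℕ) := EuclideanSpace ℝ (Fin d)

/-- Vectorized local parameters `vec Θ ∈ ℝ^(md)`; the entry `(b, a)` is `Θ a b`. -/
abbrev ParamSpace (m d : ℕ) := EuclideanSpace ℝ (Fin d × Fin m)

/-- Augmented vectors `(ψ, φ) ∈ ℝ^(m+d)`. -/
abbrev AugSpace (m d : ℕ) := EuclideanSpace ℝ (Fin m ⊕ Fin d)

/-- Slow variables `ξ = (ρ_i, σ_i)_{i < K}`. -/
abbrev SlowSpace (K d : ℕ) := Fin K → ℝ × RegSpace d

/-- Fast variables: the local parameters of the `s` modes. -/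
abbrev FastSpace (s m d : ℕ) := Fin s → ParamSpace m d

/-- Observations `(ψ, φ)`. -/
abbrev Sample (m d : ℕ) := OutSpace m × RegSpace d

/-- The augmented vector `[ψᵀ φᵀ]ᵀ`. -/
noncomputable def augVec {m d : ℕ} (ψ : OutSpace m) (φ : RegSpace d) : AugSpace m d :=
  WithLp.toLp 2 (Sum.elim (fun a => ψ a) (fun b => φ b))

/-- The local model `[φᵀ ⊗ I_m] θ`. -/
noncomputable def localModel {m d : ℕ} (φ : RegSpace d) (θ : ParamSpace m d) : OutSpace m :=
  WithLp.toLp 2 (fun a => ∑ b, φ b * θ (b, a))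

/-- The transpose of the local model, `[φᵀ ⊗ I_m]ᵀ e`. -/
noncomputable def localModelT {m d : ℕ} (φ : RegSpace d) (e : OutSpace m) : ParamSpace m d :=
  WithLp.toLp 2 (fun p => φ p.1 * e p.2)

/-- Fixed ingredients of the algorithm with `K` codevectors and `s` modes: the temperature
coefficient, the generators of the Bregman divergences on the augmented space, the regressor space
and the parameter space, and the rule that assigns to the `j`-th codevector the mode whose
parameter is nearest to the parameter `localParam θ j` attached to that codevector. -/
structure IdentificationModel (K s m d : ℕ) where
  temp : ℝ
  temp_pos : 0 < temp
  temp_lt_one : temp < 1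
  genAug : AugSpace m d → ℝ
  genAug_bregman : IsBregmanGenerator genAug
  genReg : RegSpace d → ℝ
  genReg_bregman : IsBregmanGenerator genReg
  genParam : ParamSpace m d → ℝ
  genParam_bregman : IsBregmanGenerator genParam
  localParam : FastSpace s m d → Fin K → ParamSpace m d
  assign : FastSpace s m d → Fin K → Fin s
  assign_nearest : ∀ θ j k,
    bregman genParam (localParam θ j) (θ (assign θ j)) ≤ bregman genParam (localParam θ j) (θ k)

/-- The codevector `σ_i / ρ_i`. -/
noncomputable def codevector {K d : ℕ} (ξ : SlowSpace K d) (i : Fin K) : RegSpace d :=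
  (ξ i).1⁻¹ • (ξ i).2

namespace IdentificationModel

variable {K s m d : ℕ} (A : IdentificationModel K s m d)

/-- The augmented codevector `μ_i`, made of the prediction of the mode assigned to `i` and of the
codevector `σ_i / ρ_i`. -/
noncomputable def augCodevector (ξ : SlowSpace K d) (θ : FastSpace s m d) (φ : RegSpace d)
    (i : Fin K) : AugSpace m d :=
  augVec (localModel φ (θ (A.assign θ i))) (codevector ξ i)

/-- The unnormalized association weight `ρ_i exp(-((1-λ)/λ) d(x, μ_i))`. -/
noncomputable def weight (ξ : SlowSpace K d) (θ : FastSpace s m d) (x : Sample m d)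
    (i : Fin K) : ℝ :=
  (ξ i).1 * Real.exp (-((1 - A.temp) / A.temp) *
    bregman A.genAug (augVec x.1 x.2) (A.augCodevector ξ θ x.2 i))

/-- The association probability `p̂_i`. -/
noncomputable def assocProb (ξ : SlowSpace K d) (θ : FastSpace s m d) (x : Sample m d)
    (i : Fin K) : ℝ :=
  A.weight ξ θ x i / ∑ j, A.weight ξ θ x j

/-- The increment `(p̂_i - ρ_i, φ p̂_i - σ_i)_i` of online deterministic annealing. -/
noncomputable def odaIncrement (ξ : SlowSpace K d) (θ : FastSpace s m d) (x : Sample m d) :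
    SlowSpace K d :=
  fun i => (A.assocProb ξ θ x i - (ξ i).1, A.assocProb ξ θ x i • x.2 - (ξ i).2)

/-- The Voronoi cell `Σ_i` of the `i`-th codevector, ties going to the smallest index. -/
def voronoiCell (ξ : SlowSpace K d) (i : Fin K) : Set (RegSpace d) :=
  {φ | (∀ j, bregman A.genReg φ (codevector ξ i) ≤ bregman A.genReg φ (codevector ξ j)) ∧
    ∀ j < i, bregman A.genReg φ (codevector ξ i) < bregman A.genReg φ (codevector ξ j)}

/-- The region `S_i` of the `i`-th mode: the union of the Voronoi cells assigned to it. -/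
def modeRegion (ξ : SlowSpace K d) (θ : FastSpace s m d) (i : Fin s) : Set (RegSpace d) :=
  {φ | ∃ j, A.assign θ j = i ∧ φ ∈ A.voronoiCell ξ j}

/-- The prediction error `ε = ∑ i, 1[φ ∈ S_i] [φᵀ ⊗ I_m] θ_i - ψ`. -/
noncomputable def predictionError (ξ : SlowSpace K d) (θ : FastSpace s m d) (x : Sample m d) :
    OutSpace m :=
  ∑ i, (A.modeRegion ξ θ i).indicator (fun φ => localModel φ (θ i)) x.2 - x.1

/-- The increment of stochastic gradient descent on `½ ‖ε‖²` with respect to the mode parameters,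
`-1[φ ∈ S_i] [φᵀ ⊗ I_m]ᵀ ε`. -/
noncomputable def sgdIncrement (ξ : SlowSpace K d) (θ : FastSpace s m d) (x : Sample m d) :
    FastSpace s m d :=
  fun i => -(A.modeRegion ξ θ i).indicator
    (fun φ => localModelT φ (A.predictionError ξ θ x)) x.2

/-- The drift of online deterministic annealing: the mean increment when `(ψ, φ)` has law `Q`. -/
noncomputable def odaDrift (Q : Measure (Sample m d)) (ξ : SlowSpace K d)
    (θ : FastSpace s m d) : SlowSpace K d :=
  ∫ x, A.odaIncrement ξ θ x ∂Q

/-- The drift of the recursive identification: the mean increment when `(ψ, φ)` has law `Q`. -/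
noncomputable def sgdDrift (Q : Measure (Sample m d)) (ξ : SlowSpace K d)
    (θ : FastSpace s m d) : FastSpace s m d :=
  ∫ x, A.sgdIncrement ξ θ x ∂Q

/-- The noise of the annealing recursion: `M (t + 1)` is the increment at time `t` minus its
drift (the value at time `0` is never used). -/
noncomputable def odaNoise {Ω : Type*} (Q : Measure (Sample m d)) (x : ℕ → Ω → Sample m d)
    (ξ : ℕ → Ω → SlowSpace K d) (θ : ℕ → Ω → FastSpace s m d) : ℕ → Ω → SlowSpace K d
  | 0, _ => 0
  | t + 1, ω => A.odaIncrement (ξ t ω) (θ t ω) (x t ω) - A.odaDrift Q (ξ t ω) (θ t ω)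

/-- The noise of the identification recursion, with the same convention. -/
noncomputable def sgdNoise {Ω : Type*} (Q : Measure (Sample m d)) (x : ℕ → Ω → Sample m d)
    (ξ : ℕ → Ω → SlowSpace K d) (θ : ℕ → Ω → FastSpace s m d) : ℕ → Ω → FastSpace s m d
  | 0, _ => 0
  | t + 1, ω => A.sgdIncrement (ξ t ω) (θ t ω) (x t ω) - A.sgdDrift Q (ξ t ω) (θ t ω)

end IdentificationModel

/-! ### Limits of approximate solutions and complete orbits -/

/-! The proof is the ODE method, run path by path with ultrafilter limits. Compactness gives a limit
point of the iterates along every ultrafilter, so it suffices to identify these points. Read at the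
clock `∑ a k`, a perturbed Euler scheme confined to a compact set has, along an ultrafilter, limits
at all real times at once, and these form an orbit defined on all of ℝ
(`exists_complete_orbit_of_recursion`). Such an orbit in the region of an asymptotically stable
equilibrium is constant: going back in time it comes arbitrarily close to the equilibrium, and
Lyapunov stability keeps it there up to time 0 (`eq_of_complete_orbit`). This is used twice. On the
clock of `α` the slow variable is frozen, so limit points lie on the graph of `lam`. Hence `hslow x
y - hslow x (lam x)` tends to 0, and on the clock of `β` the slow variable alone follows the slow
ODE. Probability enters only through the almost sure convergence of the weighted noise sums, by L²
martingale convergence after truncation (`IsMartingaleNoise.ae_cauchySeq_sum`). -/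

section Deterministic

variable {E : Type*} [NormedAddCommGroup E] [NormedSpace ℝ E]

/-- The expansion with error `η * |t - s|` survives pointwise limits and is already
differentiability, so neither uniform convergence nor an integral equation is needed. The remainder
`r` may depend on `s` and `t`, since it vanishes before `t → s`. -/
theorem hasDerivAt_of_tendsto_approx_solutions {ι : Type*} {l : Filter ι} [l.NeBot] {f : E → E}
    {C : Set E} (hf : ContinuousOn f C) {y : ι → ℝ → E} {z : ℝ → E}
    (hy : ∀ t, Tendsto (fun i => y i t) l (𝓝 (z t))) (hmem : ∀ t, ∀ᶠ i in l, y i t ∈ C)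
    (hz : ∀ t, z t ∈ C)
    (happ : ∀ η > 0, ∃ δ > 0, ∀ s t, |t - s| < δ → ∃ r : ι → ℝ, Tendsto r l (𝓝 0) ∧
      ∀ᶠ i in l, ‖y i t - y i s - (t - s) • f (y i s)‖ ≤ η * |t - s| + r i) (t : ℝ) :
    HasDerivAt z (f (z t)) t := by
  rw [hasDerivAt_iff_isLittleO, Asymptotics.isLittleO_iff]
  intro η hη
  obtain ⟨δ, hδ, H⟩ := happ η hη
  filter_upwards [Metric.ball_mem_nhds t hδ] with u hu
  rw [Metric.mem_ball, Real.dist_eq] at hu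
  obtain ⟨r, hr, hle⟩ := H t u hu
  have hft : Tendsto (fun i => f (y i t)) l (𝓝 (f (z t))) :=
    (hf (z t) (hz t)).tendsto.comp (tendsto_nhdsWithin_iff.2 ⟨hy t, hmem t⟩)
  have h1 := (((hy u).sub (hy t)).sub (hft.const_smul (u - t))).norm
  have h2 := hr.const_add (η * |u - t|)
  rw [add_zero] at h2
  simpa [Real.norm_eq_abs] using le_of_tendsto_of_tendsto h1 h2 hle

/-- One ultrafilter serves uncountably many times at once, which replaces Arzelà–Ascoli and diagonal
subsequences. -/
theorem IsCompact.exists_pointwise_limit {X ι T : Type*} [TopologicalSpace X] {C : Set X}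
    (hC : IsCompact C) (𝒰 : Ultrafilter ι) {y : ι → T → X} (hy : ∀ t, ∀ᶠ i in 𝒰, y i t ∈ C) :
    ∃ z : T → X, (∀ t, z t ∈ C) ∧ ∀ t, Tendsto (fun i => y i t) 𝒰 (𝓝 (z t)) := by
  have : ∀ t, ∃ x ∈ C, Tendsto (fun i => y i t) 𝒰 (𝓝 x) := fun t =>
    hC.ultrafilter_le_nhds (𝒰.map fun i => y i t) (le_principal_iff.2 (hy t))
  choose z hz hlim using this
  exact ⟨z, hz, hlim⟩

/-- First-order expansion of a complete orbit in a compact set, uniform along the orbit. -/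
theorem exists_uniform_expansion {f : E → E} {C : Set E} (hC : IsCompact C)
    (hf : ContinuousOn f C) {y : ℝ → E} (hy : ∀ t, HasDerivAt y (f (y t)) t) (hmem : ∀ t, y t ∈ C)
    {η : ℝ} (hη : 0 < η) :
    ∃ δ > 0, ∀ s t, |t - s| < δ → ‖y t - y s - (t - s) • f (y s)‖ ≤ η * |t - s| := by
  obtain ⟨B, hB⟩ := hC.exists_bound_of_continuousOn hf
  have hB0 : 0 ≤ B := (norm_nonneg _).trans (hB _ (hmem 0))
  have hlip : ∀ s t, ‖y t - y s‖ ≤ B * |t - s| := fun s t => by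
    simpa [Real.norm_eq_abs] using convex_univ.norm_image_sub_le_of_norm_hasDerivWithin_le
      (fun u _ => (hy u).hasDerivWithinAt) (fun u _ => hB _ (hmem u)) (mem_univ s) (mem_univ t)
  obtain ⟨ρ, hρ, huc⟩ :=
    Metric.uniformContinuousOn_iff.1 (hC.uniformContinuousOn_of_continuous hf) η hη
  -- The orbit is `B`-Lipschitz, so within this time it moves less than `ρ` and `f` varies by at
  -- most `η`; `B + 1` avoids division by zero.
  refine ⟨ρ / (B + 1), by positivity, fun s t hst => ?_⟩
  have hder : ∀ u ∈ uIcc s t,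
      HasDerivWithinAt (fun u => y u - (u - s) • f (y s)) (f (y u) - f (y s)) (uIcc s t) u := by
    intro u _
    have h2 : HasDerivAt (fun u : ℝ => (u - s) • f (y s)) ((1 : ℝ) • f (y s)) u :=
      ((hasDerivAt_id u).sub_const s).smul_const _
    rw [one_smul] at h2
    exact ((hy u).sub h2).hasDerivWithinAt
  have hbd : ∀ u ∈ uIcc s t, ‖f (y u) - f (y s)‖ ≤ η := by
    intro u hu
    rw [← dist_eq_norm]
    refine (huc _ (hmem u) _ (hmem s) ?_).le
    rw [dist_eq_norm]
    calc ‖y u - y s‖ ≤ B * |u - s| := hlip s u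
      _ ≤ (B + 1) * |t - s| :=
        mul_le_mul (by linarith) (abs_sub_left_of_mem_uIcc hu) (abs_nonneg _) (by linarith)
      _ < ρ := by rwa [mul_comm, ← lt_div_iff₀ (by positivity)]
  have := (convex_uIcc s t).norm_image_sub_le_of_norm_hasDerivWithin_le hder hbd
    left_mem_uIcc right_mem_uIcc
  simp only [sub_self, zero_smul, sub_zero, Real.norm_eq_abs] at this
  rwa [sub_right_comm]

/-- The only complete orbit with relatively compact range in the region of an asymptotically stable
equilibrium is the equilibrium itself. -/
theorem IsAsymptoticallyStableOn.eq_of_complete_orbit {f : E → E} {D C : Set E} {x : E}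
    (h : IsAsymptoticallyStableOn f D x) (hC : IsCompact C) (hCD : C ⊆ D)
    (hf : ContinuousOn f C) {y : ℝ → E} (hy : ∀ t, HasDerivAt y (f (y t)) t)
    (hmem : ∀ t, y t ∈ C) : y 0 = x := by
  -- The time shifts of `y` towards `-∞` have a limit `z`, again a complete orbit in `C`, to which
  -- attraction applies.
  let 𝒰 : Ultrafilter ℝ := Ultrafilter.of atBot
  have h𝒰 : (𝒰 : Filter ℝ) ≤ atBot := Ultrafilter.of_le atBot
  obtain ⟨z, hzC, hz⟩ := hC.exists_pointwise_limit 𝒰 (y := fun s t => y (s + t))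
    fun t => Eventually.of_forall fun s => hmem _
  have hzder : ∀ t, HasDerivAt z (f (z t)) t := by
    refine hasDerivAt_of_tendsto_approx_solutions hf hz
      (fun t => Eventually.of_forall fun s => hmem _) hzC fun η hη => ?_
    obtain ⟨δ, hδ, H⟩ := exists_uniform_expansion hC hf hy hmem hη
    refine ⟨δ, hδ, fun s t hst => ⟨fun _ => 0, tendsto_const_nhds, Eventually.of_forall fun i => ?_⟩⟩
    simpa using H (i + s) (i + t) (by simpa using hst)
  have hattr : Tendsto z atTop (𝓝 x) := h.attractive z
    (fun t _ => (hzder t).hasDerivWithinAt) fun t _ => hCD (hzC t)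
  refine dist_le_zero.1 (le_of_forall_pos_lt_add fun ε hε => ?_)
  rw [zero_add]
  obtain ⟨δ, hδ, hst⟩ := h.stable ε hε
  -- Since `z T` is `δ`-close to `x`, so is `y (s + T)` for some `s < -T`; stability over the
  -- duration `-(s + T)` then reaches time 0.
  obtain ⟨T, hT⟩ := (hattr.eventually (Metric.ball_mem_nhds x hδ)).exists
  obtain ⟨s, hs, hsT⟩ := (((hz T).eventually (Metric.isOpen_ball.mem_nhds hT)).and
    (h𝒰 (eventually_lt_atBot (-T)))).exists
  have := hst (-(s + T)) (by linarith) (fun t => y (s + T + t))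
    (fun t _ => ((hy _).comp_const_add (s + T) t).hasDerivWithinAt)
    (fun t _ => hCD (hmem _)) (by simpa using hs) (-(s + T)) ⟨by linarith, le_rfl⟩
  simpa using this

/-! ### The ODE method for deterministic recursions -/

/-- For a divergent sequence `τ` of times with vanishing steps, an index `N s` whose time is
asymptotically `s`. -/
theorem exists_time_index {a : ℕ → ℝ} (ha : ∀ n, 0 < a n) (ha0 : Tendsto a atTop (𝓝 0))
    (hsum : Tendsto (fun n => ∑ k ∈ Finset.range n, a k) atTop atTop) :
    ∃ N : ℝ → ℕ, (∀ n, N (∑ k ∈ Finset.range n, a k) = n) ∧ Tendsto N atTop atTop ∧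
      Tendsto (fun s => ∑ k ∈ Finset.range (N s), a k - s) atTop (𝓝 0) := by
  classical
  set τ : ℕ → ℝ := fun n => ∑ k ∈ Finset.range n, a k with hτ
  have hτs : ∀ n, τ (n + 1) = τ n + a n := fun n => Finset.sum_range_succ _ _
  have hmono : StrictMono τ := strictMono_nat_of_lt_succ fun n => by
    rw [hτs]; linarith [ha n]
  have hex : ∀ s, ∃ k, s ≤ τ k := fun s => (hsum.eventually_ge_atTop s).exists
  -- The first index whose time is at least `s` overshoots by at most the last step, `a (N s - 1)`.
  let N : ℝ → ℕ := fun s => Nat.find (hex s)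
  have hN : ∀ s, s ≤ τ (N s) := fun s => Nat.find_spec (hex s)
  have hNtop : Tendsto N atTop atTop := tendsto_atTop.2 fun b => by
    filter_upwards [eventually_ge_atTop (τ b)] with s hs
    exact hmono.le_iff_le.1 (hs.trans (hN s))
  refine ⟨N, fun n => ?_, hNtop, ?_⟩
  · exact (Nat.find_eq_iff (hex (τ n))).2 ⟨le_rfl, fun k hk => not_le.2 (hmono hk)⟩
  · have hlim : Tendsto (fun s => a (N s - 1)) atTop (𝓝 0) :=
      ha0.comp ((tendsto_sub_atTop_nat 1).comp hNtop)
    refine squeeze_zero' (Eventually.of_forall fun s => sub_nonneg.2 (hN s)) ?_ hlim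
    filter_upwards [hNtop.eventually_gt_atTop 0] with s hs
    have h1 : τ (N s - 1) < s := not_le.1 (Nat.find_min (hex s) (Nat.sub_lt hs one_pos))
    have h2 := hτs (N s - 1)
    rw [Nat.sub_add_cancel hs] at h2
    linarith

theorem recursion_sub_eq {f : E → E} {x e w : ℕ → E} {a : ℕ → ℝ}
    (hrec : ∀ n, x (n + 1) = x n + a n • (f (x n) + e n) + w n) {k m : ℕ} (hkm : k ≤ m) :
    x m - x k = ∑ i ∈ Finset.Ico k m, a i • (f (x i) + e i) +
      (∑ i ∈ Finset.range m, w i - ∑ i ∈ Finset.range k, w i) := by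
  rw [← Finset.sum_Ico_eq_sub _ hkm, ← Finset.sum_add_distrib, ← Finset.sum_Ico_sub x hkm]
  refine Finset.sum_congr rfl fun i _ => ?_
  rw [hrec]; abel

/-- Over a short time window the late iterates move little, so `f` is nearly constant along them.
The noise `w` enters only through differences of its partial sums. Both orders of `k` and `m` are
needed for a two-sided derivative. -/
theorem recursion_expansion {f : E → E} {C : Set E} (hC : IsCompact C) (hf : ContinuousOn f C)
    {x e w : ℕ → E} {a : ℕ → ℝ} (ha : ∀ n, 0 < a n)
    (hrec : ∀ n, x (n + 1) = x n + a n • (f (x n) + e n) + w n)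
    (hmem : ∀ᶠ n in atTop, x n ∈ C) (he : Tendsto e atTop (𝓝 0))
    (hw : CauchySeq fun n => ∑ i ∈ Finset.range n, w i) {η : ℝ} (hη : 0 < η) :
    ∃ δ > 0, ∃ n₁, ∀ k ≥ n₁, ∀ m ≥ n₁,
      |∑ i ∈ Finset.range m, a i - ∑ i ∈ Finset.range k, a i| < δ →
      ‖x m - x k - (∑ i ∈ Finset.range m, a i - ∑ i ∈ Finset.range k, a i) • f (x k)‖ ≤
        η * |∑ i ∈ Finset.range m, a i - ∑ i ∈ Finset.range k, a i| +
          ‖∑ i ∈ Finset.range m, w i - ∑ i ∈ Finset.range k, w i‖ := by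
  set τ : ℕ → ℝ := fun n => ∑ k ∈ Finset.range n, a k with hτ
  set W : ℕ → E := fun n => ∑ k ∈ Finset.range n, w k with hW
  have hmono : Monotone τ := monotone_nat_of_le_succ fun n => by
    simp only [hτ, Finset.sum_range_succ]; linarith [ha n]
  have hτI : ∀ {k m : ℕ}, k ≤ m → ∑ i ∈ Finset.Ico k m, a i = τ m - τ k := fun hkm =>
    Finset.sum_Ico_eq_sub _ hkm
  obtain ⟨B, hB⟩ := hC.exists_bound_of_continuousOn hf
  obtain ⟨ρ, hρ, huc⟩ :=
    Metric.uniformContinuousOn_iff.1 (hC.uniformContinuousOn_of_continuous hf) (η / 2) (by linarith)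
  obtain ⟨n₂, hn₂⟩ := eventually_atTop.1 hmem
  obtain ⟨n₃, hn₃⟩ := Metric.cauchySeq_iff.1 hw (ρ / 2) (by linarith)
  -- The bound 1 on `e` gives drifts of norm at most `B + 1`; the bound `η / 2` leaves the other
  -- half of `η` to the variation of `f`. Likewise noise and drift each get half of `ρ`.
  obtain ⟨n₄, hn₄⟩ := eventually_atTop.1
    (he.norm.eventually (gt_mem_nhds (by simpa using hη : ‖(0 : E)‖ < min (η / 2) 1)))
  have hB0 : 0 ≤ B := (norm_nonneg _).trans (hB _ (hn₂ n₂ le_rfl))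
  have hclose : ∀ i ≥ max n₂ (max n₃ n₄), ∀ j, i ≤ j → τ j - τ i < ρ / 2 / (B + 1) →
      dist (x j) (x i) < ρ := by
    intro i hi j hij hd
    simp only [ge_iff_le, max_le_iff] at hi
    rw [dist_eq_norm, recursion_sub_eq hrec hij]
    have h1 : ‖∑ u ∈ Finset.Ico i j, a u • (f (x u) + e u)‖ ≤ (τ j - τ i) * (B + 1) := by
      rw [← hτI hij, Finset.sum_mul]
      refine norm_sum_le_of_le _ fun u hu => ?_
      rw [Finset.mem_Ico] at hu
      rw [norm_smul, Real.norm_eq_abs, abs_of_pos (ha u)]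
      have := lt_min_iff.1 (hn₄ u (by omega))
      have := norm_add_le (f (x u)) (e u)
      have := hB _ (hn₂ u (by omega))
      exact mul_le_mul_of_nonneg_left (by linarith) (ha u).le
    have h2 := hn₃ j (by omega) i (by omega)
    rw [dist_eq_norm] at h2
    rw [lt_div_iff₀ (by positivity)] at hd
    have := norm_add_le (∑ u ∈ Finset.Ico i j, a u • (f (x u) + e u)) (W j - W i)
    linarith
  have hfclose : ∀ k ≥ max n₂ (max n₃ n₄), ∀ m, τ m - τ k < ρ / 2 / (B + 1) →
      ∀ i j, k ≤ i → i ≤ m → k ≤ j → j ≤ m → ‖f (x i) - f (x j)‖ ≤ η / 2 := by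
    intro k hk m hd i j hki him hkj hjm
    rw [← dist_eq_norm]
    have := hmono hki; have := hmono him; have := hmono hkj; have := hmono hjm
    simp only [ge_iff_le, max_le_iff] at hk
    refine (huc _ (hn₂ i (by omega)) _ (hn₂ j (by omega)) ?_).le
    rcases le_total i j with hij | hij
    · rw [dist_comm]
      exact hclose i (by simp; omega) j hij (by linarith)
    · exact hclose j (by simp; omega) i hij (by linarith)
  -- The base point `j` is free in the window: the left end serves forward increments, the right end
  -- backward ones.
  have key : ∀ k ≥ max n₂ (max n₃ n₄), ∀ m, k ≤ m → τ m - τ k < ρ / 2 / (B + 1) →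
      ∀ j, k ≤ j → j ≤ m →
        ‖x m - x k - (τ m - τ k) • f (x j)‖ ≤ η * (τ m - τ k) + ‖W m - W k‖ := by
    intro k hk m hkm hd j hkj hjm
    have heq : x m - x k - (τ m - τ k) • f (x j) =
        ∑ i ∈ Finset.Ico k m, a i • (f (x i) - f (x j) + e i) + (W m - W k) := by
      rw [recursion_sub_eq hrec hkm, ← hτI hkm, Finset.sum_smul, add_sub_right_comm,
        ← Finset.sum_sub_distrib]
      congr 1
      refine Finset.sum_congr rfl fun i _ => ?_
      rw [← smul_sub]; congr 1; abel
    rw [heq]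
    refine (norm_add_le _ _).trans (add_le_add_left ?_ _)
    rw [← hτI hkm, Finset.mul_sum]
    refine norm_sum_le_of_le _ fun u hu => ?_
    rw [Finset.mem_Ico] at hu
    rw [norm_smul, Real.norm_eq_abs, abs_of_pos (ha u), mul_comm]
    simp only [ge_iff_le, max_le_iff] at hk
    have := lt_min_iff.1 (hn₄ u (by omega))
    have := norm_add_le (f (x u) - f (x j)) (e u)
    have := hfclose k (by simp; omega) m hd u j hu.1 hu.2.le hkj hjm
    exact mul_le_mul_of_nonneg_right (by linarith) (ha u).le
  refine ⟨ρ / 2 / (B + 1), by positivity, max n₂ (max n₃ n₄), fun k hk m hm hd => ?_⟩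
  rcases le_total k m with hkm | hkm
  · have hpos : 0 ≤ τ m - τ k := sub_nonneg.2 (hmono hkm)
    rw [abs_of_nonneg hpos] at hd ⊢
    exact key k hk m hkm hd k le_rfl hkm
  · have hpos : 0 ≤ τ k - τ m := sub_nonneg.2 (hmono hkm)
    rw [abs_sub_comm, abs_of_nonneg hpos] at hd
    rw [abs_sub_comm, abs_of_nonneg hpos, norm_sub_rev (W m)]
    have := key m hm k hkm hd k hkm le_rfl
    rw [← norm_neg]
    refine (congrArg norm ?_).trans_le this
    rw [← neg_sub (τ k) (τ m), neg_smul]; abel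

/-- Every limit point of a perturbed Euler scheme with vanishing steps that stays in a compact set
lies on a complete orbit of the limiting ODE in that set. -/
theorem exists_complete_orbit_of_recursion {f : E → E} {C : Set E} (hC : IsCompact C)
    (hf : ContinuousOn f C) {x e w : ℕ → E} {a : ℕ → ℝ} (ha : ∀ n, 0 < a n)
    (ha0 : Tendsto a atTop (𝓝 0))
    (hsum : Tendsto (fun n => ∑ k ∈ Finset.range n, a k) atTop atTop)
    (hrec : ∀ n, x (n + 1) = x n + a n • (f (x n) + e n) + w n)
    (hmem : ∀ᶠ n in atTop, x n ∈ C) (he : Tendsto e atTop (𝓝 0))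
    (hw : CauchySeq fun n => ∑ i ∈ Finset.range n, w i)
    {𝒰 : Ultrafilter ℕ} (h𝒰 : (𝒰 : Filter ℕ) ≤ atTop) {p : E} (hp : Tendsto x 𝒰 (𝓝 p)) :
    ∃ y : ℝ → E, y 0 = p ∧ (∀ t, y t ∈ C) ∧ ∀ t, HasDerivAt y (f (y t)) t := by
  obtain ⟨N, hNτ, hNtop, hN0⟩ := exists_time_index ha ha0 hsum
  set τ : ℕ → ℝ := fun n => ∑ k ∈ Finset.range n, a k with hτ
  have hshift : ∀ t, Tendsto (fun n => τ n + t) 𝒰 atTop := fun t =>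
    (tendsto_atTop_add_const_right _ t hsum).mono_left h𝒰
  have hidx : ∀ t, Tendsto (fun n => N (τ n + t)) 𝒰 atTop := fun t => hNtop.comp (hshift t)
  have hCmem : ∀ t, ∀ᶠ n in 𝒰, x (N (τ n + t)) ∈ C := fun t => (hidx t).eventually hmem
  -- Negative `t` is allowed because `τ n + t` tends to infinity for every real `t`; this makes the
  -- orbit complete.
  obtain ⟨y, hyC, hy⟩ := hC.exists_pointwise_limit 𝒰 (y := fun n t => x (N (τ n + t))) hCmem
  obtain ⟨B, hB⟩ := hC.exists_bound_of_continuousOn hf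
  refine ⟨y, ?_, hyC, hasDerivAt_of_tendsto_approx_solutions hf hy hCmem hyC fun η hη => ?_⟩
  · refine tendsto_nhds_unique (hy 0) ?_
    simpa only [hτ, add_zero, hNτ] using hp
  obtain ⟨δ, hδ, n₁, H⟩ := recursion_expansion hC hf ha hrec hmem he hw hη
  refine ⟨δ, hδ, fun s t hst => ?_⟩
  have hdiff : Tendsto (fun n => τ (N (τ n + t)) - τ (N (τ n + s)) - (t - s)) 𝒰 (𝓝 0) := by
    have := (hN0.comp (hshift t)).sub (hN0.comp (hshift s))
    rw [sub_zero] at this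
    refine this.congr fun n => ?_
    simp only [Function.comp]; ring
  have hWdiff : Tendsto (fun n => ‖∑ i ∈ Finset.range (N (τ n + t)), w i -
      ∑ i ∈ Finset.range (N (τ n + s)), w i‖) 𝒰 (𝓝 0) := by
    rw [Metric.tendsto_nhds]
    intro ε hε
    obtain ⟨n₂, hn₂⟩ := Metric.cauchySeq_iff.1 hw ε hε
    filter_upwards [(hidx t).eventually_ge_atTop n₂, (hidx s).eventually_ge_atTop n₂] with n h1 h2
    simpa [dist_eq_norm] using hn₂ _ h1 _ h2
  -- The clock mismatch costs `η` in the error term and `B` in the linear term; the second summand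
  -- is the noise.
  refine ⟨fun n => (η + B) * |τ (N (τ n + t)) - τ (N (τ n + s)) - (t - s)| +
    ‖∑ i ∈ Finset.range (N (τ n + t)), w i - ∑ i ∈ Finset.range (N (τ n + s)), w i‖, ?_, ?_⟩
  · simpa using (hdiff.abs.const_mul (η + B)).add hWdiff
  have hlt : ∀ᶠ n in (𝒰 : Filter ℕ), |τ (N (τ n + t)) - τ (N (τ n + s))| < δ := by
    have h1 := (hdiff.add_const (t - s)).abs
    simp only [sub_add_cancel, zero_add] at h1
    exact h1.eventually (gt_mem_nhds hst)
  filter_upwards [hlt, (hidx t).eventually_ge_atTop n₁, (hidx s).eventually_ge_atTop n₁, hCmem s]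
    with n hn h1 h2 h3
  have key := H _ h2 _ h1 hn
  set D := τ (N (τ n + t)) - τ (N (τ n + s)) with hD
  have hsplit : x (N (τ n + t)) - x (N (τ n + s)) - (t - s) • f (x (N (τ n + s))) =
      (x (N (τ n + t)) - x (N (τ n + s)) - D • f (x (N (τ n + s)))) +
        (D - (t - s)) • f (x (N (τ n + s))) := by
    rw [sub_smul D]; abel
  have hDabs : |D| ≤ |D - (t - s)| + |t - s| := by
    simpa using abs_add_le (D - (t - s)) (t - s)
  have h4 : ‖(D - (t - s)) • f (x (N (τ n + s)))‖ ≤ |D - (t - s)| * B := by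
    rw [norm_smul, Real.norm_eq_abs]
    exact mul_le_mul_of_nonneg_left (hB _ h3) (abs_nonneg _)
  have h5 := mul_le_mul_of_nonneg_left hDabs hη.le
  change ‖x (N (τ n + t)) - x (N (τ n + s)) - (t - s) • f (x (N (τ n + s)))‖ ≤ _
  rw [hsplit]
  refine (norm_add_le _ _).trans ?_
  linarith

end Deterministic

/-! ### Convergence of weighted sums of martingale noise -/

section Probability

variable {Ω : Type*} {mΩ : MeasurableSpace Ω} {P : Measure Ω} [IsProbabilityMeasure P]
  {ℱ : Filtration ℕ mΩ}

theorem integral_mul_eq_zero_of_condExp_eq_zero {m : MeasurableSpace Ω} (hm : m ≤ mΩ) {f g : Ω → ℝ}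
    (hf : StronglyMeasurable[m] f) (hf2 : MemLp f 2 P) (hg2 : MemLp g 2 P)
    (hg : P[g | m] =ᵐ[P] 0) : ∫ ω, f ω * g ω ∂P = 0 := by
  have hfg : Integrable (f * g) P := hf2.integrable_mul hg2
  have h := condExp_mul_of_stronglyMeasurable_left hf hfg (hg2.integrable one_le_two)
  calc ∫ ω, f ω * g ω ∂P = ∫ ω, (P[f * g | m]) ω ∂P := (integral_condExp hm).symm
    _ = ∫ _, (0 : ℝ) ∂P := by
      refine integral_congr_ae ?_
      filter_upwards [h, hg] with ω h1 h2
      simp [h1, h2]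
    _ = 0 := by simp

/-- Increments are orthogonal, so second moments of the partial sums stay below `∑' k, v k`; then
`|S| ≤ 1 + S ^ 2` gives the L¹ bound for submartingale convergence. -/
theorem ae_exists_tendsto_sum_of_martingale_differences {d : ℕ → Ω → ℝ} {v : ℕ → ℝ}
    (hd : ∀ k, StronglyMeasurable[ℱ (k + 1)] (d k)) (hd2 : ∀ k, MemLp (d k) 2 P)
    (hd0 : ∀ k, P[d k | ℱ k] =ᵐ[P] 0) (hv : ∀ k, ∫ ω, d k ω ^ 2 ∂P ≤ v k) (hsum : Summable v) :
    ∀ᵐ ω ∂P, ∃ c, Tendsto (fun n => ∑ k ∈ Finset.range n, d k ω) atTop (𝓝 c) := by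
  set S : ℕ → Ω → ℝ := fun n ω => ∑ k ∈ Finset.range n, d k ω with hS
  have hSm : ∀ n, StronglyMeasurable[ℱ n] (S n) := fun n =>
    Finset.stronglyMeasurable_fun_sum _ fun k hk =>
      (hd k).mono (ℱ.mono (Nat.succ_le_of_lt (Finset.mem_range.1 hk)))
  have hS2 : ∀ n, MemLp (S n) 2 P := fun n => memLp_finsetSum _ fun k _ => hd2 k
  have hSsucc : ∀ n ω, S (n + 1) ω = S n ω + d n ω := fun n ω => Finset.sum_range_succ _ _
  have hmart : Martingale S ℱ P := by
    refine martingale_of_condExp_sub_eq_zero_nat hSm (fun n => (hS2 n).integrable one_le_two)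
      fun n => ?_
    have : S (n + 1) - S n = d n := by ext ω; simp [hSsucc]
    rw [this]; exact hd0 n
  have hv0 : ∀ k, 0 ≤ v k := fun k => (integral_nonneg fun ω => sq_nonneg _).trans (hv k)
  have hbound : ∀ n, ∫ ω, S n ω ^ 2 ∂P ≤ ∑ k ∈ Finset.range n, v k := by
    intro n
    induction n with
    | zero => simp [hS]
    | succ n ih =>
      have h1 : ∫ ω, S (n + 1) ω ^ 2 ∂P =
          ∫ ω, S n ω ^ 2 ∂P + 2 * ∫ ω, S n ω * d n ω ∂P + ∫ ω, d n ω ^ 2 ∂P := by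
        have i1 := (hS2 n).integrable_sq
        have i2 := (hd2 n).integrable_sq
        have i3 : Integrable (fun ω => S n ω * d n ω) P := (hS2 n).integrable_mul (hd2 n)
        have i4 : Integrable (fun ω => S n ω ^ 2 + 2 * (S n ω * d n ω)) P :=
          i1.add (i3.const_mul 2)
        rw [← integral_const_mul, ← integral_add i1 (i3.const_mul 2), ← integral_add i4 i2]
        refine integral_congr_ae (Eventually.of_forall fun ω => ?_)
        simp only [hSsucc]; ring
      rw [h1, integral_mul_eq_zero_of_condExp_eq_zero (ℱ.le n) (hSm n) (hS2 n) (hd2 n) (hd0 n),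
        Finset.sum_range_succ]
      linarith [hv n]
  refine hmart.submartingale.exists_ae_tendsto_of_bdd (R := (1 + ∑' k, v k).toNNReal) fun n => ?_
  rw [eLpNorm_one_eq_lintegral_enorm, ← ofReal_integral_norm_eq_lintegral_enorm
    ((hS2 n).integrable one_le_two), ENNReal.ofReal]
  refine ENNReal.coe_le_coe.2 (Real.toNNReal_le_toNNReal ?_)
  calc ∫ ω, ‖S n ω‖ ∂P ≤ ∫ ω, (1 + S n ω ^ 2) ∂P := by
        refine integral_mono ((hS2 n).integrable one_le_two).norm
          ((integrable_const 1).add (hS2 n).integrable_sq) fun ω => ?_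
        rw [Real.norm_eq_abs, ← sq_abs (S n ω)]
        nlinarith [sq_nonneg (|S n ω| - 1)]
    _ = 1 + ∫ ω, S n ω ^ 2 ∂P := by
        rw [integral_add (integrable_const 1) (hS2 n).integrable_sq]; simp
    _ ≤ 1 + ∑' k, v k := by
        gcongr
        exact (hbound n).trans (hsum.sum_le_tsum _ fun k _ => hv0 k)

theorem IsMartingaleNoise.integral_indicator_sq_le {E F V : Type*}
    [NormedAddCommGroup E] [NormedAddCommGroup F] [NormedAddCommGroup V] [NormedSpace ℝ V]
    [CompleteSpace V] {ξ : ℕ → Ω → E} {θ : ℕ → Ω → F} {M : ℕ → Ω → V} {c : ℝ}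
    (hM : IsMartingaleNoise P ℱ ξ θ M)
    (hc : ∀ t, ∀ᵐ ω ∂P,
      (P[fun ω' => ‖M (t + 1) ω'‖ ^ 2 | ℱ t]) ω ≤ c * (1 + ‖ξ t ω‖ ^ 2 + ‖θ t ω‖ ^ 2))
    {t : ℕ} {A : Set Ω} (hA : MeasurableSet[ℱ t] A) {r : ℝ} (hr : 0 ≤ r)
    (hAr : ∀ ω ∈ A, ‖ξ t ω‖ ^ 2 + ‖θ t ω‖ ^ 2 ≤ r) :
    ∫ ω in A, ‖M (t + 1) ω‖ ^ 2 ∂P ≤ |c| * (1 + r) := by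
  have hint : Integrable (fun ω => ‖M (t + 1) ω‖ ^ 2) P := (hM.memLp t).integrable_norm_pow two_ne_zero
  rw [← setIntegral_condExp (ℱ.le t) hint hA]
  calc ∫ ω in A, (P[fun ω' => ‖M (t + 1) ω'‖ ^ 2 | ℱ t]) ω ∂P ≤ ∫ _ in A, |c| * (1 + r) ∂P := by
        refine setIntegral_mono_on_ae integrable_condExp.integrableOn
          (integrable_const _).integrableOn (ℱ.le t _ hA) ?_
        filter_upwards [hc t] with ω h hω
        refine h.trans ((mul_le_mul_of_nonneg_right (le_abs_self c) (by positivity)).trans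
          (mul_le_mul_of_nonneg_left ?_ (abs_nonneg c)))
        linarith [hAr ω hω]
    _ ≤ |c| * (1 + r) := by
        rw [setIntegral_const, smul_eq_mul]
        exact mul_le_of_le_one_left (by positivity) measureReal_le_one

/-- The iterates have no deterministic bound. The truncation event at time `k` belongs to `ℱ k`, so
it preserves the martingale difference property and caps the variance. -/
theorem IsMartingaleNoise.ae_exists_tendsto_sum_truncated {E F V : Type*}
    [NormedAddCommGroup E] [NormedAddCommGroup F] [NormedAddCommGroup V] [NormedSpace ℝ V]
    [CompleteSpace V] {ξ : ℕ → Ω → E} {θ : ℕ → Ω → F} {M : ℕ → Ω → V}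
    (hM : IsMartingaleNoise P ℱ ξ θ M)
    (hξ : ∀ t, StronglyMeasurable[ℱ t] (ξ t)) (hθ : ∀ t, StronglyMeasurable[ℱ t] (θ t))
    {a : ℕ → ℝ} (ha : Summable fun n => a n ^ 2) (ℓ : V →L[ℝ] ℝ) {r : ℝ} (hr : 0 ≤ r) :
    ∀ᵐ ω ∂P, ∃ c, Tendsto (fun n => ∑ k ∈ Finset.range n,
      {ω' | ‖ξ k ω'‖ ^ 2 + ‖θ k ω'‖ ^ 2 ≤ r}.indicator
        (fun ω' => a k * ℓ (M (k + 1) ω')) ω) atTop (𝓝 c) := by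
  obtain ⟨c, hc⟩ := hM.growth
  have hA : ∀ k, MeasurableSet[ℱ k] {ω' | ‖ξ k ω'‖ ^ 2 + ‖θ k ω'‖ ^ 2 ≤ r} := fun k =>
    StronglyMeasurable.measurableSet_le (((hξ k).norm.pow 2).add ((hθ k).norm.pow 2))
      stronglyMeasurable_const
  have hℓ2 : ∀ k, MemLp (fun ω' => a k * ℓ (M (k + 1) ω')) 2 P := fun k =>
    (ℓ.comp_memLp' (hM.memLp k)).const_mul (a k)
  refine ae_exists_tendsto_sum_of_martingale_differences (ℱ := ℱ)
    (v := fun k => a k ^ 2 * (‖ℓ‖ ^ 2 * (|c| * (1 + r)))) (fun k => ?_)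
    (fun k => (hℓ2 k).indicator (ℱ.le k _ (hA k))) (fun k => ?_) (fun k => ?_) (ha.mul_right _)
  · exact ((ℓ.continuous.comp_stronglyMeasurable (hM.adapted k)).const_mul (a k)).indicator
      (ℱ.mono k.le_succ _ (hA k))
  · have h1 := condExp_indicator ((hℓ2 k).integrable one_le_two) (hA k)
    have h2 := (a k • ℓ).comp_condExp_comm (m := ℱ k) ((hM.memLp k).integrable one_le_two)
    refine h1.trans ?_
    filter_upwards [h2, hM.condExp_eq_zero k] with ω h3 h4
    have h5 : (P[fun ω' => a k * ℓ (M (k + 1) ω') | ℱ k]) ω = 0 := by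
      refine Eq.trans h3.symm ?_
      simp [h4]
    by_cases hω : ω ∈ {ω' | ‖ξ k ω'‖ ^ 2 + ‖θ k ω'‖ ^ 2 ≤ r} <;> simp only [indicator, hω, h5] <;> simp
  · have hint : Integrable (fun ω => ‖M (k + 1) ω‖ ^ 2) P :=
      (hM.memLp k).integrable_norm_pow two_ne_zero
    have h1 : ∀ ω, ({ω' | ‖ξ k ω'‖ ^ 2 + ‖θ k ω'‖ ^ 2 ≤ r}.indicator
        (fun ω' => a k * ℓ (M (k + 1) ω')) ω) ^ 2 ≤
        {ω' | ‖ξ k ω'‖ ^ 2 + ‖θ k ω'‖ ^ 2 ≤ r}.indicator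
          (fun ω' => a k ^ 2 * (‖ℓ‖ ^ 2 * ‖M (k + 1) ω'‖ ^ 2)) ω := by
      intro ω
      by_cases hω : ω ∈ {ω' | ‖ξ k ω'‖ ^ 2 + ‖θ k ω'‖ ^ 2 ≤ r}
      · rw [indicator_of_mem hω, indicator_of_mem hω, mul_pow, ← mul_pow ‖ℓ‖]
        refine mul_le_mul_of_nonneg_left (sq_le_sq' ?_ ?_) (sq_nonneg _)
        · exact (abs_le.1 (ℓ.le_opNorm (M (k + 1) ω))).1
        · exact (abs_le.1 (ℓ.le_opNorm (M (k + 1) ω))).2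
      · simp [indicator_of_notMem hω]
    refine (integral_mono ((hℓ2 k).indicator (ℱ.le k _ (hA k))).integrable_sq
      (((hint.const_mul (‖ℓ‖ ^ 2)).const_mul (a k ^ 2)).indicator (ℱ.le k _ (hA k))) h1).trans ?_
    rw [integral_indicator (ℱ.le k _ (hA k)), integral_const_mul, integral_const_mul]
    gcongr
    exact hM.integral_indicator_sq_le hc (hA k) hr fun ω hω => hω

/-- On each path some integer level `N` truncates only finitely many terms; countably many levels
and finitely many coordinates share one null set. -/
theorem IsMartingaleNoise.ae_cauchySeq_sum {E F V : Type*}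
    [NormedAddCommGroup E] [NormedAddCommGroup F] [NormedAddCommGroup V] [NormedSpace ℝ V]
    [FiniteDimensional ℝ V] [CompleteSpace V] {ξ : ℕ → Ω → E} {θ : ℕ → Ω → F} {M : ℕ → Ω → V}
    (hM : IsMartingaleNoise P ℱ ξ θ M)
    (hξ : ∀ t, StronglyMeasurable[ℱ t] (ξ t)) (hθ : ∀ t, StronglyMeasurable[ℱ t] (θ t))
    {a : ℕ → ℝ} (ha : Summable fun n => a n ^ 2)
    (hbdd : ∀ᵐ ω ∂P, ∃ r, ∀ᶠ t in atTop, ‖ξ t ω‖ ^ 2 + ‖θ t ω‖ ^ 2 ≤ r) :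
    ∀ᵐ ω ∂P, CauchySeq fun n => ∑ k ∈ Finset.range n, a k • M (k + 1) ω := by
  let b := Module.finBasis ℝ V
  let Φ := b.equivFun.toContinuousLinearEquiv
  have hae : ∀ᵐ ω ∂P, ∀ (N : ℕ) (i : Fin (Module.finrank ℝ V)), ∃ c,
      Tendsto (fun n => ∑ k ∈ Finset.range n, {ω' | ‖ξ k ω'‖ ^ 2 + ‖θ k ω'‖ ^ 2 ≤ (N : ℝ)}.indicator
        (fun ω' => a k * Φ (M (k + 1) ω') i) ω) atTop (𝓝 c) :=
    ae_all_iff.2 fun N => ae_all_iff.2 fun i => hM.ae_exists_tendsto_sum_truncated hξ hθ ha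
      ((ContinuousLinearMap.proj i).comp (Φ : V →L[ℝ] (Fin (Module.finrank ℝ V) → ℝ)))
      (Nat.cast_nonneg N)
  filter_upwards [hae, hbdd] with ω h ⟨r, hr⟩
  obtain ⟨N, hN⟩ := exists_nat_ge r
  obtain ⟨n₀, hn₀⟩ := eventually_atTop.1 hr
  have hcoord : ∀ i, ∃ c, Tendsto (fun n => ∑ k ∈ Finset.range n, a k * Φ (M (k + 1) ω) i)
      atTop (𝓝 c) := by
    intro i
    obtain ⟨c, hc⟩ := h N i
    set u : ℕ → ℝ := fun k => {ω' | ‖ξ k ω'‖ ^ 2 + ‖θ k ω'‖ ^ 2 ≤ (N : ℝ)}.indicator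
      (fun ω' => a k * Φ (M (k + 1) ω') i) ω
    set u' : ℕ → ℝ := fun k => a k * Φ (M (k + 1) ω) i
    have heq : ∀ k ≥ n₀, u k = u' k := fun k hk =>
      indicator_of_mem (s := {ω' | ‖ξ k ω'‖ ^ 2 + ‖θ k ω'‖ ^ 2 ≤ (N : ℝ)}) ((hn₀ k hk).trans hN) _
    refine ⟨c + (∑ k ∈ Finset.range n₀, u' k - ∑ k ∈ Finset.range n₀, u k),
      (hc.add_const _).congr' ?_⟩
    filter_upwards [eventually_ge_atTop n₀] with n hn
    rw [← Finset.sum_range_add_sum_Ico u hn, ← Finset.sum_range_add_sum_Ico u' hn,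
      Finset.sum_congr rfl fun k hk => heq k (Finset.mem_Ico.1 hk).1]
    ring
  choose c hc using hcoord
  have hΦ : Tendsto (fun n => Φ (∑ k ∈ Finset.range n, a k • M (k + 1) ω)) atTop (𝓝 c) := by
    refine tendsto_pi_nhds.2 fun i => (hc i).congr fun n => ?_
    simp [map_sum, Finset.sum_apply]
  have := (Φ.symm.continuous.tendsto c).comp hΦ
  refine (this.congr fun n => ?_).cauchySeq
  simp only [Function.comp, ContinuousLinearEquiv.symm_apply_apply]

end Probability

/-! ### Two-timescale recursions -/

section TwoTimescale

variable {E F : Type*} [NormedAddCommGroup E] [NormedSpace ℝ E]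
  [NormedAddCommGroup F] [NormedSpace ℝ F]

theorem IsTwoTimescaleStepsize.summable_sq {α β : ℕ → ℝ} (h : IsTwoTimescaleStepsize α β) :
    (Summable fun n => α n ^ 2) ∧ Summable fun n => β n ^ 2 :=
  ⟨h.sq_summable.of_nonneg_of_le (fun _ => sq_nonneg _) fun _ => le_add_of_nonneg_right (sq_nonneg _),
    h.sq_summable.of_nonneg_of_le (fun _ => sq_nonneg _) fun _ => le_add_of_nonneg_left (sq_nonneg _)⟩

theorem tendsto_zero_of_summable_sq {a : ℕ → ℝ} (h : Summable fun n => a n ^ 2) :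
    Tendsto a atTop (𝓝 0) := by
  have := h.tendsto_atTop_zero.sqrt
  simp only [Real.sqrt_sq_eq_abs, Real.sqrt_zero] at this
  exact (tendsto_zero_iff_abs_tendsto_zero a).2 this

section

variable {α β : ℕ → ℝ} {U : Set E} {V : Set F} {hslow : E → F → E} {hfast : E → F → F}
  {lam : E → F} {x u : ℕ → E} {y v : ℕ → F} {C : Set (E × F)}

/-- On the fast timescale the slow variable is frozen, so limit points lie on the graph of the
equilibrium map of the fast ODE. -/
theorem fast_limit_point_eq (hstep : IsTwoTimescaleStepsize α β)
    (hslowc : ContinuousOn (fun p : E × F => hslow p.1 p.2) (U ×ˢ V))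
    (hfastc : ContinuousOn (fun p : E × F => hfast p.1 p.2) (U ×ˢ V))
    (hfast_ode : ∀ x ∈ U, IsAsymptoticallyStableOn (hfast x) V (lam x))
    (hC : IsCompact C) (hCUV : C ⊆ U ×ˢ V) (hmem : ∀ᶠ n in atTop, (x n, y n) ∈ C)
    (hx : ∀ n, x (n + 1) = x n + β n • (hslow (x n) (y n) + u n))
    (hy : ∀ n, y (n + 1) = y n + α n • (hfast (x n) (y n) + v n))
    (hu : CauchySeq fun n => ∑ k ∈ Finset.range n, β k • u k)
    (hv : CauchySeq fun n => ∑ k ∈ Finset.range n, α k • v k)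
    {𝒰 : Ultrafilter ℕ} (h𝒰 : (𝒰 : Filter ℕ) ≤ atTop) {p : E × F}
    (hp : Tendsto (fun n => (x n, y n)) 𝒰 (𝓝 p)) : p.2 = lam p.1 := by
  -- Writing `β n = α n * (β n / α n)` turns the slow drift, bounded on `C`, into a vanishing
  -- perturbation of the field `(0, hfast)`.
  have he : Tendsto (fun n => ((β n / α n) • hslow (x n) (y n), (0 : F))) atTop (𝓝 0) := by
    obtain ⟨B, hB⟩ := hC.exists_bound_of_continuousOn (hslowc.mono hCUV)
    refine Tendsto.prodMk_nhds ?_ tendsto_const_nhds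
    exact hstep.ratio.zero_smul_isBoundedUnder_le
      ⟨B, eventually_map.2 (hmem.mono fun n hn => hB _ hn)⟩
  have hw : CauchySeq fun n => ∑ k ∈ Finset.range n, (β k • u k, α k • v k) := by
    convert hu.prodMk hv using 2 with n
    simp [Prod.ext_iff, Prod.fst_sum, Prod.snd_sum]
  obtain ⟨z, hz0, hzC, hz⟩ := exists_complete_orbit_of_recursion (f := fun p : E × F =>
      ((0 : E), hfast p.1 p.2)) hC (continuousOn_const.prodMk (hfastc.mono hCUV))
    (x := fun n => (x n, y n)) (w := fun k => (β k • u k, α k • v k)) hstep.fast_pos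
    (tendsto_zero_of_summable_sq hstep.summable_sq.1) hstep.fast_sum (fun n => by
      have h1 : α n * (β n / α n) = β n := mul_div_cancel₀ _ (hstep.fast_pos n).ne'
      ext
      · simp [hx, smul_smul, h1, add_assoc]
      · simp [hy, add_assoc]) hmem he hw h𝒰 hp
  have hz1 : ∀ t, HasDerivAt (fun t => (z t).1) 0 t := fun t =>
    (hasFDerivAt_fst (𝕜 := ℝ) (p := z t)).comp_hasDerivAt t (hz t)
  have hconst : ∀ t, (z t).1 = p.1 := fun t => by
    rw [← hz0]
    exact is_const_of_deriv_eq_zero (fun s => (hz1 s).differentiableAt) (fun s => (hz1 s).deriv) t 0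
  have hz2 : ∀ t, HasDerivAt (fun t => (z t).2) (hfast p.1 (z t).2) t := fun t => by
    have : HasDerivAt (fun t => (z t).2) (hfast (z t).1 (z t).2) t :=
      (hasFDerivAt_snd (𝕜 := ℝ) (p := z t)).comp_hasDerivAt t (hz t)
    rwa [hconst] at this
  have hpU : p.1 ∈ U := by
    rw [← hz0]; exact (hCUV (hzC 0)).1
  -- Pairing `p.1` with second coordinates of `C` may leave `C`, but not the product `U ×ˢ V`.
  have := (hfast_ode p.1 hpU).eq_of_complete_orbit (hC.image continuous_snd)
    (by rintro _ ⟨q, hq, rfl⟩; exact (hCUV hq).2)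
    (hfastc.comp (continuousOn_const.prodMk continuousOn_id)
      (by rintro _ ⟨q, hq, rfl⟩; exact ⟨hpU, (hCUV hq).2⟩)) hz2
    fun t => mem_image_of_mem _ (hzC t)
  rw [← this, hz0]

theorem tendsto_of_two_timescale_recursion (hstep : IsTwoTimescaleStepsize α β)
    (hslowc : ContinuousOn (fun p : E × F => hslow p.1 p.2) (U ×ˢ V))
    (hfastc : ContinuousOn (fun p : E × F => hfast p.1 p.2) (U ×ˢ V))
    (hlam : ContinuousOn lam U)
    (hfast_ode : ∀ x ∈ U, IsAsymptoticallyStableOn (hfast x) V (lam x)) {xlim : E}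
    (hslow_ode : IsAsymptoticallyStableOn (fun x => hslow x (lam x)) U xlim)
    (hC : IsCompact C) (hCUV : C ⊆ U ×ˢ V) (hmem : ∀ᶠ n in atTop, (x n, y n) ∈ C)
    (hx : ∀ n, x (n + 1) = x n + β n • (hslow (x n) (y n) + u n))
    (hy : ∀ n, y (n + 1) = y n + α n • (hfast (x n) (y n) + v n))
    (hu : CauchySeq fun n => ∑ k ∈ Finset.range n, β k • u k)
    (hv : CauchySeq fun n => ∑ k ∈ Finset.range n, α k • v k) :
    Tendsto (fun n => (x n, y n)) atTop (𝓝 (xlim, lam xlim)) := by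
  have hcluster : ∀ 𝒰 : Ultrafilter ℕ, (𝒰 : Filter ℕ) ≤ atTop → ∃ q ∈ U, lam q ∈ V ∧
      Tendsto (fun n => (x n, y n)) 𝒰 (𝓝 (q, lam q)) := by
    intro 𝒰 h𝒰
    obtain ⟨p, hpC, hp⟩ := hC.ultrafilter_le_nhds (𝒰.map fun n => (x n, y n))
      (le_principal_iff.2 (h𝒰 hmem))
    have heq : p.2 = lam p.1 := fast_limit_point_eq hstep hslowc hfastc hfast_ode hC hCUV hmem hx hy
      hu hv h𝒰 hp
    refine ⟨p.1, (hCUV hpC).1, heq ▸ (hCUV hpC).2, ?_⟩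
    rw [← heq]; exact hp
  have hgraph : ContinuousOn (fun q => hslow q (lam q)) U :=
    hslowc.comp (continuousOn_id.prodMk hlam) fun q hq => ⟨hq, (hfast_ode q hq).mem⟩
  have hmemUV : ∀ᶠ n in atTop, (x n, y n) ∈ U ×ˢ V := hmem.mono fun n hn => hCUV hn
  -- Along every ultrafilter both terms have the same limit, because the limit point is on the graph
  -- of `lam`. This difference is the perturbation in the slow Euler scheme.
  have he : Tendsto (fun n => hslow (x n) (y n) - hslow (x n) (lam (x n))) atTop (𝓝 0) := by
    rw [tendsto_iff_ultrafilter]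
    intro 𝒰 h𝒰
    obtain ⟨q, hqU, hqV, hq⟩ := hcluster 𝒰 h𝒰
    have h1 := (hslowc (q, lam q) ⟨hqU, hqV⟩).tendsto.comp
      (tendsto_nhdsWithin_iff.2 ⟨hq, h𝒰 hmemUV⟩)
    have h2 := (hgraph q hqU).tendsto.comp (tendsto_nhdsWithin_iff.2
      ⟨(continuous_fst.tendsto _).comp hq, h𝒰 (hmemUV.mono fun n hn => hn.1)⟩)
    have h3 := h1.sub h2
    rw [sub_self] at h3
    exact h3
  have hCU : Prod.fst '' C ⊆ U := by rintro _ ⟨q, hq, rfl⟩; exact (hCUV hq).1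
  rw [tendsto_iff_ultrafilter]
  intro 𝒰 h𝒰
  obtain ⟨q, hqU, hqV, hq⟩ := hcluster 𝒰 h𝒰
  obtain ⟨z, hz0, hzC, hz⟩ := exists_complete_orbit_of_recursion
    (hC.image continuous_fst) (hgraph.mono hCU) (w := fun k => β k • u k) hstep.slow_pos
    (tendsto_zero_of_summable_sq hstep.summable_sq.2) hstep.slow_sum (fun n => by
      rw [hx, add_sub_cancel, smul_add, add_assoc])
    (hmem.mono fun n hn => mem_image_of_mem _ hn) he hu h𝒰 ((continuous_fst.tendsto _).comp hq)
  have hqlim : q = xlim := hz0.symm.trans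
    (hslow_ode.eq_of_complete_orbit (hC.image continuous_fst) hCU (hgraph.mono hCU) hz hzC)
  rw [← hqlim]; exact hq

end

theorem TwoTimescaleConditions.ae_tendsto {Ω : Type*} {mΩ : MeasurableSpace Ω} {P : Measure Ω}
    [IsProbabilityMeasure P] {ℱ : Filtration ℕ mΩ} [FiniteDimensional ℝ E] [CompleteSpace E]
    [FiniteDimensional ℝ F] [CompleteSpace F] {α β : ℕ → ℝ} {ξ : ℕ → Ω → E} {θ : ℕ → Ω → F}
    {U : Set E} {V : Set F} {hslow : E → F → E} {hfast : E → F → F} {Mslow : ℕ → Ω → E}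
    {Mfast : ℕ → Ω → F} {lam : E → F} {ξlim : E}
    (h : TwoTimescaleConditions P ℱ ξ θ U V hslow hfast Mslow Mfast lam ξlim)
    (hstep : IsTwoTimescaleStepsize α β)
    (hξ : ∀ t, StronglyMeasurable[ℱ t] (ξ t)) (hθ : ∀ t, StronglyMeasurable[ℱ t] (θ t))
    (hcompact : ∀ᵐ ω ∂P, ∃ C : Set (E × F),
      IsCompact C ∧ C ⊆ U ×ˢ V ∧ ∀ᶠ t in atTop, (ξ t ω, θ t ω) ∈ C)
    (hξrec : ∀ t, ∀ᵐ ω ∂P,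
      ξ (t + 1) ω = ξ t ω + β t • (hslow (ξ t ω) (θ t ω) + Mslow (t + 1) ω))
    (hθrec : ∀ t, ∀ᵐ ω ∂P,
      θ (t + 1) ω = θ t ω + α t • (hfast (ξ t ω) (θ t ω) + Mfast (t + 1) ω)) :
    ∀ᵐ ω ∂P, Tendsto (fun t => (ξ t ω, θ t ω)) atTop (𝓝 (ξlim, lam ξlim)) := by
  have hbdd : ∀ᵐ ω ∂P, ∃ r, ∀ᶠ t in atTop, ‖ξ t ω‖ ^ 2 + ‖θ t ω‖ ^ 2 ≤ r := by
    filter_upwards [hcompact] with ω ⟨C, hC, _, hmem⟩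
    obtain ⟨B, hB⟩ := hC.exists_bound_of_continuousOn
      (f := fun p : E × F => ‖p.1‖ ^ 2 + ‖p.2‖ ^ 2) (by fun_prop)
    exact ⟨B, hmem.mono fun t ht => (le_abs_self _).trans (hB _ ht)⟩
  obtain ⟨L, hL⟩ := h.lam_lipschitz
  filter_upwards [hcompact, ae_all_iff.2 hξrec, ae_all_iff.2 hθrec,
    h.slow_noise.ae_cauchySeq_sum hξ hθ hstep.summable_sq.2 hbdd,
    h.fast_noise.ae_cauchySeq_sum hξ hθ hstep.summable_sq.1 hbdd] with
    ω ⟨C, hC, hCUV, hmem⟩ hx hy hu hv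
  exact tendsto_of_two_timescale_recursion hstep h.slow_lipschitz.continuousOn
    h.fast_lipschitz.continuousOn hL.continuousOn h.fast_ode h.slow_ode hC hCUV hmem hx hy hu hv

end TwoTimescale

theorem mainTheorem1 {Ω : Type*} {mΩ : MeasurableSpace Ω} (P : Measure Ω) [IsProbabilityMeasure P]
    (ℱ : Filtration ℕ mΩ) (K s m d : ℕ) (α β : ℕ → ℝ) (hstep : IsTwoTimescaleStepsize α β)
    (ξ : ℕ → Ω → SlowSpace K d) (θ : ℕ → Ω → FastSpace s m d)
    (hξ : ∀ t, StronglyMeasurable[ℱ t] (ξ t)) (hθ : ∀ t, StronglyMeasurable[ℱ t] (θ t))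
    (U : Set (SlowSpace K d)) (V : Set (FastSpace s m d)) (hU : IsOpen U) (hV : IsOpen V)
    (hcompact : ∀ᵐ ω ∂P, ∃ C : Set (SlowSpace K d × FastSpace s m d),
      IsCompact C ∧ C ⊆ U ×ˢ V ∧ ∀ᶠ t in atTop, (ξ t ω, θ t ω) ∈ C)
    (lam : SlowSpace K d → FastSpace s m d) (ξlim : SlowSpace K d) :
    -- all recursions of stochastic approximation form
    (∀ (hslow : SlowSpace K d → FastSpace s m d → SlowSpace K d)
        (hfast : SlowSpace K d → FastSpace s m d → FastSpace s m d)
        (Mslow : ℕ → Ω → SlowSpace K d) (Mfast : ℕ → Ω → FastSpace s m d),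
        TwoTimescaleConditions P ℱ ξ θ U V hslow hfast Mslow Mfast lam ξlim →
        (∀ t, ∀ᵐ ω ∂P, ∀ i, ξ (t + 1) ω i =
          ξ t ω i + β t • (hslow (ξ t ω) (θ t ω) i + Mslow (t + 1) ω i)) →
        (∀ t, ∀ᵐ ω ∂P, ∀ i, θ (t + 1) ω i =
          θ t ω i + α t • (hfast (ξ t ω) (θ t ω) i + Mfast (t + 1) ω i)) →
        ∀ᵐ ω ∂P, Tendsto (fun t => (ξ t ω, θ t ω)) atTop (𝓝 (ξlim, lam ξlim))) ∧
    -- the online deterministic annealing and recursive identification updates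
    (∀ (A : IdentificationModel K s m d) (Q : Measure (Sample m d)) (x : ℕ → Ω → Sample m d),
        MemLp (fun y : Sample m d => y) 2 Q →
        (∀ t, HasLaw (x t) Q P) →
        (∀ y ∈ U, ∀ i, 0 < (y i).1) →
        TwoTimescaleConditions P ℱ ξ θ U V (A.odaDrift Q) (A.sgdDrift Q)
          (A.odaNoise Q x ξ θ) (A.sgdNoise Q x ξ θ) lam ξlim →
        (∀ t, ∀ᵐ ω ∂P, ∀ i,
          (ξ (t + 1) ω i).1 = (ξ t ω i).1 +
            β t * (A.assocProb (ξ t ω) (θ t ω) (x t ω) i - (ξ t ω i).1) ∧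
          (ξ (t + 1) ω i).2 = (ξ t ω i).2 +
            β t • (A.assocProb (ξ t ω) (θ t ω) (x t ω) i • (x t ω).2 - (ξ t ω i).2)) →
        (∀ t, ∀ᵐ ω ∂P, ∀ i, θ (t + 1) ω i =
          θ t ω i + α t • A.sgdIncrement (ξ t ω) (θ t ω) (x t ω) i) →
        ∀ᵐ ω ∂P, Tendsto (fun t => (ξ t ω, θ t ω)) atTop (𝓝 (ξlim, lam ξlim))) := by
  refine ⟨fun hslow hfast Mslow Mfast h hξrec hθrec => ?_, fun A Q x _ _ _ h hξrec hθrec => ?_⟩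
  · exact h.ae_tendsto hstep hξ hθ hcompact (fun t => (hξrec t).mono fun ω hω => funext hω)
      fun t => (hθrec t).mono fun ω hω => funext hω
  -- The noise is the increment minus its drift, so drift plus noise is the increment itself and the
  -- updates are instances of the general recursions.
  · refine h.ae_tendsto hstep hξ hθ hcompact (fun t => (hξrec t).mono fun ω hω => ?_)
      fun t => (hθrec t).mono fun ω hω => ?_
    · funext i
      simp only [IdentificationModel.odaNoise, add_sub_cancel]
      exact Prod.ext (hω i).1 (hω i).2
    · funext i
      simp only [IdentificationModel.sgdNoise, add_sub_cancel]
      exact hω i
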